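/- Let $U\subset\mathbb{R}^{m_u}$ and $D\subset\mathbb{R}^{m_d}$ be nonempty compact sets, and let $f:\mathbb{R}^n\times U\times D\to\mathbb{R}^n$ be uniformly continuous, bounded, and Lipschitz continuous in $x\in\mathbb{R}^n$ with a Lipschitz constant independent of $(u,d)\in U\times D$. Let $h:\mathbb{R}^n\to\mathbb{R}$ be bounded and uniformly continuous, and let $\gamma>0$. Let $\mathcal{U}^-$ and $\mathcal{D}^-$ be the sets of Lebesgue measurable functions $(-\infty,0]\to U$ and $(-\infty,0]\to D$, and let $\Xi_d^-$ be the set of non-anticipative strategies, i.e. of maps $\xi:\mathcal{U}^-\to\mathcal{D}^-$ such that for all $s\le 0$ and $\mathrm{u},\bar{\mathrm{u}}\in\mathcal{U}^-$, if $\mathrm{u}=\bar{\mathrm{u}}$ a.e. on $[s,0]$, then $\xi[\mathrm{u}]=\xi[\bar{\mathrm{u}}]$ a.e. on $[s,0]$. For $x\in\mathbb{R}^n$, $\mathrm{u}\in\mathcal{U}^-$ and $\xi\in\Xi_d^-$ let $\mathrm{x}^-:(-\infty,0]\to\mathbb{R}^n$ be the (Carathéodory) solution of $$\dot{\mathrm{x}}^-(t)=f(\mathrm{x}^-(t),\mathrm{u}(t),\xi[\mathrm{u}](t))\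 \text{ for a.e. } t<0,\qquad \mathrm{x}^-(0)=x.$$ Define the value function $$V_\gamma(x)=\sup_{\xi\in\Xi_d^-}\ \inf_{\mathrm{u}\in\mathcal{U}^-}\ \sup_{t\in(-\infty,0]}e^{\gamma t}h(\mathrm{x}^-(t))$$ and, for $T>0$ and $V$ in the set $\mathrm{BUC}(\mathbb{R}^n)$ of bounded uniformly continuous functions $\mathbb{R}^n\to\mathbb{R}$, the Bellman backup $$B_T[V](x)=\sup_{\xi\in\Xi_d^-}\ \inf_{\mathrm{u}\in\mathcal{U}^-}\ \max\Big\{\max_{t\in[-T,0]}e^{\gamma t}h(\mathrm{x}^-(t)),\ e^{-\gamma T}V(\mathrm{x}^-(-T))\Big\}.$$ Then, with $\|\cdot\|_\infty$ the supremum norm: 1. $B_T$ maps $\mathrm{BUC}(\mathbb{R}^n)$ into itself for every $T>0$, and for all $V^1,V^2\in\mathrm{BUC}(\mathbb{R}^n)$, $$\|B_T[V^1]-B_T[V^2]\|_\infty\le e^{-\gamma T}\|V^1-V^2\|_\infty.$$ 2. $V_\gamma\in\mathrm{BUC}(\mathbb{R}^n)$, and for every $T>0$, $V_\gamma$ is the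 unique $V\in\mathrm{BUC}(\mathbb{R}^n)$ with $B_T[V]=V$. 3. For every $V\in\mathrm{BUC}(\mathbb{R}^n)$, $B_T[V]\to V_\gamma$ in $\|\cdot\|_\infty$ as $T\to\infty$. -/

import Mathlib

open MeasureTheory Filter Topology

open scoped NNReal

/-- The state space `ℝⁿ` with its Euclidean norm. -/
abbrev State (n : ℕ) : Type := EuclideanSpace ℝ (Fin n)

/-- The half line `(-∞, 0]` of backward times. -/
abbrev BackwardTime : Type := Set.Iic (0 : ℝ)

/-- Lebesgue measure on `(-∞, 0]`. -/
noncomputable def timeMeasure : Measure BackwardTime :=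
  (volume : Measure ℝ).comap ((↑) : BackwardTime → ℝ)

/-- Lebesgue measurable signals `(-∞, 0] → A`. `NullMeasurable` with respect to Lebesgue
measure says that preimages of measurable (Borel) sets are Lebesgue measurable. -/
def BackwardSignal (A : Type*) [MeasurableSpace A] : Type _ :=
  {a : BackwardTime → A // NullMeasurable a timeMeasure}

/-- Two signals agree at almost every time of `[s, 0]`. -/
def AgreeFrom {A : Type*} [MeasurableSpace A] (s : ℝ) (a b : BackwardSignal A) : Prop :=
  ∀ᵐ τ : BackwardTime ∂timeMeasure, s ≤ (τ : ℝ) → a.1 τ = b.1 τ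

/-- Backward-in-time non-anticipative strategies: maps from control signals (values in `A`)
to disturbance signals (values in `B`) such that almost everywhere equality of two controls
on `[s, 0]` forces almost everywhere equality of the responses on `[s, 0]`. -/
def BackwardStrategy (A B : Type*) [MeasurableSpace A] [MeasurableSpace B] : Type _ :=
  {ξ : BackwardSignal A → BackwardSignal B //
    ∀ s : ℝ, s ≤ 0 → ∀ u v : BackwardSignal A, AgreeFrom s u v → AgreeFrom s (ξ u) (ξ v)}

/-- The conditions on the vector field: `f` is jointly uniformly continuous, Lipschitz in the
state with a constant that does not depend on the inputs, and bounded. -/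
structure VectorFieldConditions {n : ℕ} {A B : Type*} [UniformSpace A] [UniformSpace B]
    (f : State n → A → B → State n) : Prop where
  uniformContinuous : UniformContinuous (fun p : State n × A × B => f p.1 p.2.1 p.2.2)
  lipschitz : ∃ L : ℝ≥0, ∀ (a : A) (b : B), LipschitzWith L (fun x => f x a b)
  bounded : ∃ M : ℝ, 0 < M ∧ ∀ (x : State n) (a : A) (b : B), ‖f x a b‖ ≤ M

/-- `X` is the (Carathéodory) solution on `(-∞, 0]` of `X'(t) = f (X t) (u t) (d t)` for almost
every `t < 0` with `X 0 = x`, in integral form: `X t = x - ∫_{[t, 0]} f (X τ) (u τ) (d τ) dτ`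
for every `t ≤ 0`. In the subtype `(-∞, 0]` the set `Set.Ici t` is the interval `[t, 0]`. -/
structure IsBackwardTrajectory {n : ℕ} {A B : Type*} [MeasurableSpace A] [MeasurableSpace B]
    (f : State n → A → B → State n) (u : BackwardSignal A) (d : BackwardSignal B)
    (x : State n) (X : BackwardTime → State n) : Prop where
  integrableOn : ∀ t : BackwardTime,
    IntegrableOn (fun τ : BackwardTime => f (X τ) (u.1 τ) (d.1 τ)) (Set.Ici t) timeMeasure
  integral_eq : ∀ t : BackwardTime,
    X t = x - ∫ τ in Set.Ici t, f (X τ) (u.1 τ) (d.1 τ) ∂timeMeasure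

/-- The backward trajectory with terminal state `x` under the signals `u`, `d`. -/
noncomputable def backwardTrajectory {n : ℕ} {A B : Type*} [MeasurableSpace A]
    [MeasurableSpace B] (f : State n → A → B → State n) (u : BackwardSignal A)
    (d : BackwardSignal B) (x : State n) : BackwardTime → State n :=
  Classical.epsilon (fun X => IsBackwardTrajectory f u d x X)

/-- The cost functional `sup_{t ≤ 0} e^{γ t} h(x⁻(t))`, where `x⁻` is the backward trajectory of
`x` under the control `u` and the disturbance `ξ[u]`. -/
noncomputable def discountedCost {n : ℕ} {A B : Type*} [MeasurableSpace A] [MeasurableSpace B]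
    (f : State n → A → B → State n) (h : State n → ℝ) (γ : ℝ) (x : State n)
    (u : BackwardSignal A) (ξ : BackwardStrategy A B) : ℝ :=
  ⨆ t : BackwardTime, Real.exp (γ * (t : ℝ)) * h (backwardTrajectory f u (ξ.1 u) x t)

/-- The forward reachable tube value function
`V_γ(x) = sup_ξ inf_u sup_{t ≤ 0} e^{γ t} h(x⁻(t))`. -/
noncomputable def frtValue {n : ℕ} {A B : Type*} [MeasurableSpace A] [MeasurableSpace B]
    (f : State n → A → B → State n) (h : State n → ℝ) (γ : ℝ) (x : State n) : ℝ :=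
  ⨆ ξ : BackwardStrategy A B, ⨅ u : BackwardSignal A, discountedCost f h γ x u ξ

/-- The time `-T` of `(-∞, 0]`, for `T ≥ 0`. -/
def negTime (T : ℝ≥0) : BackwardTime := ⟨-(T : ℝ), neg_nonpos.mpr T.2⟩

/-- The Bellman backup `B_T[V](x) =
sup_ξ inf_u max { max_{t ∈ [-T, 0]} e^{γ t} h(x⁻(t)), e^{-γ T} V(x⁻(-T)) }`. In the subtype
`(-∞, 0]` the set `Set.Ici (negTime T)` is the interval `[-T, 0]`. -/
noncomputable def bellmanBackup {n : ℕ} {A B : Type*} [MeasurableSpace A] [MeasurableSpace B]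
    (f : State n → A → B → State n) (h : State n → ℝ) (γ : ℝ) (T : ℝ≥0) (V : State n → ℝ)
    (x : State n) : ℝ :=
  ⨆ ξ : BackwardStrategy A B, ⨅ u : BackwardSignal A,
    max
      (⨆ t : Set.Ici (negTime T),
        Real.exp (γ * (t : BackwardTime)) * h (backwardTrajectory f u (ξ.1 u) x t))
      (Real.exp (-(γ * T)) * V (backwardTrajectory f u (ξ.1 u) x (negTime T)))

/-- Bounded uniformly continuous real functions on `ℝⁿ`. -/
structure IsBUC {n : ℕ} (V : State n → ℝ) : Prop where
  bounded : ∃ C : ℝ, ∀ x, |V x| ≤ C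
  uniformContinuous : UniformContinuous V

/-- The supremum norm of a (bounded) function. -/
noncomputable def supNorm {n : ℕ} (V : State n → ℝ) : ℝ := ⨆ x, |V x|

section Caratheodory

variable {E : Type*} [NormedAddCommGroup E]

/-- A scalar integral form of Grönwall's inequality for continuous functions. -/
theorem le_mul_exp_of_le_add_integral {φ : ℝ → ℝ} (hφ : Continuous φ) {a L S : ℝ}
    (ha : 0 ≤ a) (hL : 0 ≤ L) (hφ0 : ∀ s, 0 ≤ φ s)
    (h : ∀ s ∈ Set.Icc 0 S, φ s ≤ a + L * ∫ r in (0 : ℝ)..s, φ r) :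
    ∀ s ∈ Set.Icc 0 S, φ s ≤ a * Real.exp (L * s) := by
  have hderiv : ∀ s : ℝ, HasDerivAt (fun s => a + L * ∫ r in (0 : ℝ)..s, φ r) (L * φ s) s :=
    fun s => ((intervalIntegral.integral_hasDerivAt_right (hφ.intervalIntegrable _ _)
      hφ.aestronglyMeasurable.stronglyMeasurableAtFilter hφ.continuousAt).const_mul L).const_add a
  have key := norm_le_gronwallBound_of_norm_deriv_right_le
    (f := fun s => a + L * ∫ r in (0 : ℝ)..s, φ r) (f' := fun s => L * φ s)
    (δ := a) (K := L) (ε := 0) (a := 0) (b := S)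
    (fun s _ => (hderiv s).continuousAt.continuousWithinAt)
    (fun s _ => (hderiv s).hasDerivWithinAt)
    (by simp [abs_of_nonneg ha])
    (fun s hs => by
      have h1 := h s ⟨hs.1, hs.2.le⟩
      rw [Real.norm_of_nonneg (mul_nonneg hL (hφ0 s)), add_zero]
      exact mul_le_mul_of_nonneg_left (h1.trans (le_abs_self _)) hL)
  intro s hs
  have h2 := key s hs
  rw [gronwallBound_ε0, sub_zero] at h2
  exact (h s hs).trans ((le_abs_self _).trans h2)

/-- Bounded vector fields that are Lipschitz in the state and measurable along continuous
curves. -/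
structure CaratheodoryField (G : ℝ → E → E) (L : ℝ≥0) (M : ℝ) : Prop where
  bound : ∀ r y, ‖G r y‖ ≤ M
  lipschitz : ∀ r, LipschitzWith L (G r)
  measurable : ∀ Y : ℝ → E, Continuous Y → AEStronglyMeasurable (fun r => G r (Y r)) volume

namespace CaratheodoryField

variable {G G' : ℝ → E → E} {L : ℝ≥0} {M : ℝ}

theorem intervalIntegrable (hG : CaratheodoryField G L M) {Y : ℝ → E} (hY : Continuous Y)
    (a b : ℝ) : IntervalIntegrable (fun r => G r (Y r)) volume a b := by
  rw [intervalIntegrable_iff]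
  exact Measure.integrableOn_of_bounded (M := M) (by simp)
    (hG.measurable Y hY) (Eventually.of_forall fun r => hG.bound r _)

theorem norm_sub_le [NormedSpace ℝ E] (hG : CaratheodoryField G L M) (hG' : CaratheodoryField G' L M)
    {Y Y' : ℝ → E} (hY : Continuous Y) (hY' : Continuous Y') {x x' : E} {S : ℝ}
    (hGG' : ∀ᵐ r : ℝ, 0 ≤ r → r ≤ S → G r = G' r)
    (h : ∀ s ∈ Set.Icc 0 S, Y s = x + ∫ r in (0 : ℝ)..s, G r (Y r))
    (h' : ∀ s ∈ Set.Icc 0 S, Y' s = x' + ∫ r in (0 : ℝ)..s, G' r (Y' r)) :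
    ∀ s ∈ Set.Icc 0 S, ‖Y s - Y' s‖ ≤ ‖x - x'‖ * Real.exp (L * s) := by
  refine le_mul_exp_of_le_add_integral (hY.sub hY').norm (norm_nonneg _) L.2
    (fun _ => norm_nonneg _) fun s hs => ?_
  have e : Y s - Y' s = (x - x') + ∫ r in (0 : ℝ)..s, (G r (Y r) - G' r (Y' r)) := by
    rw [h s hs, h' s hs, intervalIntegral.integral_sub (hG.intervalIntegrable hY _ _)
      (hG'.intervalIntegrable hY' _ _)]
    abel
  change ‖Y s - Y' s‖ ≤ _ + _ * ∫ r in (0 : ℝ)..s, ‖Y r - Y' r‖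
  rw [e]
  refine (norm_add_le _ _).trans (add_le_add_right ?_ _)
  rw [← intervalIntegral.integral_const_mul]
  refine intervalIntegral.norm_integral_le_of_norm_le hs.1 ?_
    (((hY.sub hY').norm.const_mul _).intervalIntegrable _ _)
  filter_upwards [hGG'] with r hr hrs
  rw [← hr hrs.1.le (hrs.2.trans hs.2)]
  exact (hG.lipschitz r).norm_sub_le _ _

theorem exists_solution [NormedSpace ℝ E] [CompleteSpace E] (hG : CaratheodoryField G L M) (x : E) :
    ∃ Y : ℝ → E, Continuous Y ∧ ∀ s, 0 ≤ s → Y s = x + ∫ r in (0 : ℝ)..s, G r (Y r) := by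
  have hM : 0 ≤ M := (norm_nonneg _).trans (hG.bound 0 0)
  set l : ℝ := L + 1 with hl
  have hl0 : 0 < l := by positivity
  let C : (BoundedContinuousFunction ℝ E) → ℝ → E :=
    fun Z r => x + Real.exp (l * max r 0) • Z r
  have hC : ∀ Z, Continuous (C Z) := fun Z => by
    have := Z.continuous
    fun_prop
  have hint : ∀ Z, Continuous fun s : ℝ => ∫ r in (0 : ℝ)..max s 0, G r (C Z r) := fun Z =>
    (intervalIntegral.continuous_primitive
      (fun a b => hG.intervalIntegrable (hC Z) a b) 0).comp (by fun_prop)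
  have hse : ∀ s : ℝ, 0 ≤ s → s * Real.exp (-(l * s)) ≤ 1 / l := fun s hs => by
    rw [Real.exp_neg, ← div_eq_mul_inv, div_le_div_iff₀ (Real.exp_pos _) hl0]
    nlinarith [Real.add_one_le_exp (l * s)]
  let Φ : (BoundedContinuousFunction ℝ E) → (BoundedContinuousFunction ℝ E) := fun Z =>
    BoundedContinuousFunction.ofNormedAddCommGroup
      (fun s => Real.exp (-(l * max s 0)) • ∫ r in (0 : ℝ)..max s 0, G r (C Z r))
      (Continuous.smul (by fun_prop) (hint Z)) (M * (1 / l)) (fun s => by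
        have h0 : 0 ≤ max s 0 := le_max_right _ _
        have h1 := intervalIntegral.norm_integral_le_of_norm_le_const
          (a := 0) (b := max s 0) (f := fun r => G r (C Z r)) (C := M)
          (fun r _ => hG.bound r _)
        rw [sub_zero, abs_of_nonneg h0] at h1
        rw [norm_smul, Real.norm_of_nonneg (Real.exp_pos _).le]
        calc _ ≤ Real.exp (-(l * max s 0)) * (M * max s 0) := by gcongr
          _ = M * (max s 0 * Real.exp (-(l * max s 0))) := by ring
          _ ≤ _ := mul_le_mul_of_nonneg_left (hse _ h0) hM)
  have hK1 : (L / (L + 1) : ℝ≥0) < 1 := by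
    rw [div_lt_one (by positivity)]
    exact lt_add_one L
  have hcontr : ContractingWith (L / (L + 1)) Φ := by
    refine ⟨hK1, LipschitzWith.of_dist_le_mul fun Z Z' => ?_⟩
    refine (BoundedContinuousFunction.dist_le (by positivity)).2 fun s => ?_
    have h0 : 0 ≤ max s 0 := le_max_right _ _
    change dist (Real.exp (-(l * max s 0)) • ∫ r in (0 : ℝ)..max s 0, G r (C Z r))
      (Real.exp (-(l * max s 0)) • ∫ r in (0 : ℝ)..max s 0, G r (C Z' r)) ≤ _
    generalize max s 0 = t at h0 ⊢
    rw [dist_eq_norm, ← smul_sub, norm_smul, Real.norm_of_nonneg (Real.exp_pos _).le,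
      ← intervalIntegral.integral_sub (hG.intervalIntegrable (hC Z) _ _)
        (hG.intervalIntegrable (hC Z') _ _)]
    have h1 : ‖∫ r in (0 : ℝ)..t, (G r (C Z r) - G r (C Z' r))‖
        ≤ ∫ r in (0 : ℝ)..t, L * dist Z Z' * Real.exp (l * r) := by
      refine intervalIntegral.norm_integral_le_of_norm_le h0 ?_
        (Continuous.intervalIntegrable (by fun_prop) _ _)
      refine Eventually.of_forall fun r hr => ((hG.lipschitz r).norm_sub_le _ _).trans ?_
      rw [mul_assoc]
      refine mul_le_mul_of_nonneg_left ?_ L.2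
      simp only [C, add_sub_add_left_eq_sub, max_eq_left hr.1.le]
      rw [← smul_sub, norm_smul, Real.norm_of_nonneg (Real.exp_pos _).le, mul_comm]
      refine mul_le_mul_of_nonneg_right ?_ (Real.exp_pos _).le
      rw [← dist_eq_norm]
      exact BoundedContinuousFunction.dist_coe_le_dist r
    rw [intervalIntegral.integral_const_mul,
      intervalIntegral.integral_comp_mul_left (fun y => Real.exp y) hl0.ne', integral_exp] at h1
    simp only [mul_zero, Real.exp_zero, smul_eq_mul] at h1
    refine (mul_le_mul_of_nonneg_left h1 (Real.exp_pos _).le).trans ?_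
    have h2 : Real.exp (-(l * t)) * Real.exp (l * t) = 1 := by
      rw [← Real.exp_add]; simp
    have h3 : Real.exp (-(l * t)) * (L * dist Z Z' * (l⁻¹ * (Real.exp (l * t) - 1)))
        = L / l * dist Z Z' * (1 - Real.exp (-(l * t))) := by
      field_simp
      linear_combination (L * dist Z Z' : ℝ) * h2
    rw [h3]
    push_cast
    rw [← hl]
    have h4 : 0 ≤ (L : ℝ) / l * dist Z Z' := by positivity
    nlinarith [Real.exp_pos (-(l * t))]
  obtain ⟨Z, hZ⟩ : ∃ Z, Φ Z = Z := ⟨_, hcontr.fixedPoint_isFixedPt⟩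
  refine ⟨C Z, hC Z, fun s hs => ?_⟩
  have h1 : Z s = Real.exp (-(l * max s 0)) • ∫ r in (0 : ℝ)..max s 0, G r (C Z r) :=
    congrArg (fun F : BoundedContinuousFunction ℝ E => F s) hZ.symm
  rw [max_eq_left hs] at h1
  change x + Real.exp (l * max s 0) • Z s = _
  rw [h1, max_eq_left hs, smul_smul, ← Real.exp_add]
  simp

end CaratheodoryField

end Caratheodory

section TimeMeasure

theorem measurePreserving_coe_timeMeasure :
    MeasurePreserving ((↑) : BackwardTime → ℝ) timeMeasure (volume.restrict (Set.Iic 0)) :=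
  ⟨measurable_subtype_coe, map_comap_subtype_coe measurableSet_Iic _⟩

theorem projIic_coe (τ : BackwardTime) : Set.projIic 0 (τ : ℝ) = τ :=
  Set.projIic_of_mem τ.2

theorem coe_projIic_of_nonpos {r : ℝ} (hr : r ≤ 0) : (Set.projIic 0 r : ℝ) = r :=
  min_eq_right hr

theorem ae_timeMeasure_iff {p : BackwardTime → Prop} :
    (∀ᵐ τ ∂timeMeasure, p τ) ↔ ∀ᵐ r : ℝ, r ≤ 0 → p (Set.projIic 0 r) := by
  have h := ae_restrict_iff_subtype (μ := (volume : Measure ℝ)) (s := Set.Iic (0 : ℝ))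
    measurableSet_Iic (p := fun r => p (Set.projIic 0 r))
  simp only [projIic_coe] at h
  rw [timeMeasure, ← h, ae_restrict_iff' measurableSet_Iic]
  rfl

theorem map_coe_restrict_Ici_timeMeasure (t : BackwardTime) :
    MeasurePreserving ((↑) : BackwardTime → ℝ) (timeMeasure.restrict (Set.Ici t))
      (volume.restrict (Set.Icc (t : ℝ) 0)) := by
  have h := measurePreserving_coe_timeMeasure.restrict_preimage_emb
    (MeasurableEmbedding.subtype_coe measurableSet_Iic) (Set.Ici (t : ℝ))
  rwa [Measure.restrict_restrict measurableSet_Ici, Set.Ici_inter_Iic] at h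

variable {E : Type*} [NormedAddCommGroup E]

theorem integrableOn_Ici_timeMeasure_iff (F : BackwardTime → E) (t : BackwardTime) :
    IntegrableOn F (Set.Ici t) timeMeasure ↔
      IntervalIntegrable (fun r => F (Set.projIic 0 (-r))) volume 0 (-t) := by
  have h := (map_coe_restrict_Ici_timeMeasure t).integrable_comp_emb
    (MeasurableEmbedding.subtype_coe measurableSet_Iic) (g := fun r => F (Set.projIic 0 r))
  rw [IntervalIntegrable.iff_comp_neg]
  simp only [Function.comp_def, projIic_coe] at h
  simp only [neg_neg, neg_zero]
  have comm : ∀ g : ℝ → E, IntervalIntegrable g volume 0 t ↔ IntervalIntegrable g volume t 0 :=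
    fun _ => ⟨IntervalIntegrable.symm, IntervalIntegrable.symm⟩
  rw [IntegrableOn, h, comm, intervalIntegrable_iff_integrableOn_Icc_of_le t.2,
    IntegrableOn]

theorem setIntegral_Ici_timeMeasure [NormedSpace ℝ E] (F : BackwardTime → E) (t : BackwardTime) :
    ∫ τ in Set.Ici t, F τ ∂timeMeasure = ∫ r in (0 : ℝ)..(-t), F (Set.projIic 0 (-r)) := by
  have h := (map_coe_restrict_Ici_timeMeasure t).integral_comp
    (MeasurableEmbedding.subtype_coe measurableSet_Iic) (fun r => F (Set.projIic 0 r))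
  simp only [projIic_coe] at h
  rw [h, intervalIntegral.integral_comp_neg (fun r => F (Set.projIic 0 r)), neg_neg, neg_zero,
    intervalIntegral.integral_of_le t.2, integral_Icc_eq_integral_Ioc]

end TimeMeasure

section Signals

variable {A B : Type*} [MeasurableSpace A] [MeasurableSpace B]

theorem nullMeasurable_comp_projIic {a : BackwardTime → A} (ha : NullMeasurable a timeMeasure) :
    NullMeasurable (fun r : ℝ => a (Set.projIic 0 r)) volume := by
  intro s hs
  have h1 : NullMeasurableSet (((↑) : BackwardTime → ℝ) '' (a ⁻¹' s)) volume :=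
    Measure.NullMeasurableSet.subtype_coe measurableSet_Iic.nullMeasurableSet (ha hs)
  have h2 : NullMeasurableSet {r : ℝ | 0 < r ∧ a ⟨0, Set.self_mem_Iic⟩ ∈ s} volume :=
    (measurableSet_Ioi.inter (MeasurableSet.const (a ⟨0, Set.self_mem_Iic⟩ ∈ s))).nullMeasurableSet
  convert h1.union h2 using 1
  ext r
  rcases le_or_gt r 0 with hr | hr
  · have : Set.projIic 0 r = ⟨r, hr⟩ := Set.projIic_of_mem hr
    simp [this, hr, hr.not_gt]
  · have : Set.projIic 0 r = ⟨0, Set.self_mem_Iic⟩ := Set.projIic_of_le hr.le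
    simp [this, hr, hr.not_ge]

theorem agreeFrom_iff {s : ℝ} {a b : BackwardSignal A} :
    AgreeFrom s a b ↔
      ∀ᵐ r : ℝ, r ≤ 0 → s ≤ r → a.1 (Set.projIic 0 r) = b.1 (Set.projIic 0 r) := by
  rw [AgreeFrom, ae_timeMeasure_iff]
  refine eventually_congr (Eventually.of_forall fun r => forall_congr' fun hr => ?_)
  rw [coe_projIic_of_nonpos hr]

theorem AgreeFrom.refl (s : ℝ) (a : BackwardSignal A) : AgreeFrom s a a :=
  Eventually.of_forall fun _ _ => rfl

theorem AgreeFrom.mono {s s' : ℝ} {a b : BackwardSignal A} (h : AgreeFrom s a b) (hs : s ≤ s') :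
    AgreeFrom s' a b :=
  Eventually.mono h fun _ hτ h' => hτ (hs.trans h')

/-- The time `τ - T`. -/
def shiftTime (T : ℝ≥0) (τ : BackwardTime) : BackwardTime :=
  ⟨τ - T, sub_nonpos.2 (le_trans τ.2 T.2)⟩

theorem shiftTime_projIic (T : ℝ≥0) {r : ℝ} (hr : r ≤ 0) :
    shiftTime T (Set.projIic 0 r) = Set.projIic 0 (r - T) := by
  have hrT : r - T ≤ 0 := sub_nonpos.2 (hr.trans T.2)
  exact Subtype.ext ((congrArg (· - (T : ℝ)) (coe_projIic_of_nonpos hr)).trans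
    (coe_projIic_of_nonpos hrT).symm)

theorem nullMeasurable_comp_coe {g : ℝ → A} (hg : NullMeasurable g volume) :
    NullMeasurable (fun τ : BackwardTime => g τ) timeMeasure :=
  hg.comp_quasiMeasurePreserving
    (measurePreserving_coe_timeMeasure.quasiMeasurePreserving.mono_right
      Measure.restrict_le_self.absolutelyContinuous)

theorem nullMeasurable_comp_sub {g : ℝ → A} (hg : NullMeasurable g volume) (T : ℝ) :
    NullMeasurable (fun r => g (r - T)) volume :=
  hg.comp_quasiMeasurePreserving (measurePreserving_sub_right volume T).quasiMeasurePreserving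

/-- The signal `τ ↦ a (τ - T)`. -/
def shiftSignal (T : ℝ≥0) (a : BackwardSignal A) : BackwardSignal A :=
  ⟨fun τ => a.1 (shiftTime T τ), by
    have h := nullMeasurable_comp_coe
      (nullMeasurable_comp_sub (nullMeasurable_comp_projIic a.2) T)
    convert h using 2 with τ
    rw [← shiftTime_projIic T τ.2, projIic_coe]⟩

/-- The signal equal to `a` on `(-T, 0]` and to the copy of `b` delayed to start at `-T` before. -/
noncomputable def concatSignal (T : ℝ≥0) (a b : BackwardSignal A) : BackwardSignal A :=
  ⟨fun τ => if -(T : ℝ) < τ then a.1 τ else b.1 (Set.projIic 0 (τ + T)), by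
    have hb := nullMeasurable_comp_sub (nullMeasurable_comp_projIic b.2) (-T)
    simp only [sub_neg_eq_add] at hb
    exact Measurable.ite (m := eventuallyMeasurableSpace inferInstance (ae timeMeasure))
      (measurableSet_lt measurable_const measurable_subtype_coe).nullMeasurableSet a.2
      (nullMeasurable_comp_coe hb)⟩

theorem shiftSignal_concatSignal (T : ℝ≥0) (a b : BackwardSignal A) :
    shiftSignal T (concatSignal T a b) = b := by
  refine Subtype.ext (funext fun τ => ?_)
  have h : ¬ -(T : ℝ) < τ - T := by
    have := τ.2
    simp only [Set.mem_Iic] at this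
    linarith
  simp only [shiftSignal, concatSignal, shiftTime, h, if_false, sub_add_cancel, projIic_coe]

theorem AgreeFrom.shiftSignal {s : ℝ} {a b : BackwardSignal A} (T : ℝ≥0)
    (h : AgreeFrom (s - T) a b) : AgreeFrom s (shiftSignal T a) (shiftSignal T b) := by
  rw [agreeFrom_iff] at h ⊢
  rw [← eventually_sub_right_iff volume (T : ℝ)] at h
  filter_upwards [h] with r hr hr0 hsr
  have := hr (sub_nonpos.2 (hr0.trans T.2)) (by linarith)
  rwa [← shiftTime_projIic T hr0] at this

theorem AgreeFrom.concatSignal {s : ℝ} {a a' b b' : BackwardSignal A} (T : ℝ≥0)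
    (ha : AgreeFrom (max s (-T)) a a') (hb : s < -T → AgreeFrom (s + T) b b') :
    AgreeFrom s (concatSignal T a b) (concatSignal T a' b') := by
  rw [agreeFrom_iff] at ha ⊢
  rcases lt_or_ge s (-T : ℝ) with hs | hs
  · have hb := agreeFrom_iff.1 (hb hs)
    rw [← eventually_sub_right_iff volume (-T : ℝ)] at hb
    filter_upwards [ha, hb] with r har hbr hr0 hsr
    simp only [_root_.concatSignal, coe_projIic_of_nonpos hr0]
    split_ifs with hT
    · exact har hr0 (max_le hsr hT.le)
    · rw [sub_neg_eq_add] at hbr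
      exact hbr (by linarith) (by linarith)
  · filter_upwards [ha, measure_eq_zero_iff_ae_notMem.1 (measure_singleton (μ := volume) (-T : ℝ))]
      with r har hrT hr0 hsr
    have hT : -(T : ℝ) < r := lt_of_le_of_ne (hs.trans hsr) (Ne.symm hrT)
    simp only [_root_.concatSignal, coe_projIic_of_nonpos hr0, hT, if_true]
    exact har hr0 (max_le hsr hT.le)

theorem agreeFrom_concatSignal_left (T : ℝ≥0) (a b : BackwardSignal A) :
    AgreeFrom (-T) (concatSignal T a b) a := by
  rw [agreeFrom_iff]
  filter_upwards [measure_eq_zero_iff_ae_notMem.1 (measure_singleton (μ := volume) (-T : ℝ))]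
    with r hrT hr0 hsr
  have hT : -(T : ℝ) < r := lt_of_le_of_ne hsr (Ne.symm hrT)
  simp only [_root_.concatSignal, coe_projIic_of_nonpos hr0, hT, if_true]

instance [Nonempty A] : Nonempty (BackwardSignal A) :=
  ⟨⟨fun _ => Classical.arbitrary A, measurable_const.nullMeasurable⟩⟩

instance [Nonempty B] : Nonempty (BackwardStrategy A B) :=
  ⟨⟨fun _ => Classical.arbitrary _, fun s _ _ _ _ => AgreeFrom.refl s _⟩⟩

end Signals

section Trajectory

variable {n : ℕ} {A B : Type*} [MeasurableSpace A] [MeasurableSpace B]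
  {f : State n → A → B → State n} {u u' : BackwardSignal A} {d d' : BackwardSignal B}

/-- The time-reversed dynamics along the signals `u`, `d`, as a field on the whole line. -/
noncomputable def reversedField (f : State n → A → B → State n) (u : BackwardSignal A)
    (d : BackwardSignal B) (r : ℝ) (y : State n) : State n :=
  -f y (u.1 (Set.projIic 0 (-r))) (d.1 (Set.projIic 0 (-r)))

theorem setIntegral_eq_neg_reversedField {x : State n} (X : BackwardTime → State n) (t : BackwardTime) :
    x - ∫ τ in Set.Ici t, f (X τ) (u.1 τ) (d.1 τ) ∂timeMeasure
      = x + ∫ r in (0 : ℝ)..(-t), reversedField f u d r (X (Set.projIic 0 (-r))) := by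
  rw [setIntegral_Ici_timeMeasure]
  simp only [reversedField]
  rw [intervalIntegral.integral_neg, sub_eq_add_neg]

theorem IsBackwardTrajectory.eq_add_integral {x : State n} {X : BackwardTime → State n}
    (hX : IsBackwardTrajectory f u d x X) {s : ℝ} (hs : 0 ≤ s) :
    X (Set.projIic 0 (-s))
      = x + ∫ r in (0 : ℝ)..s, reversedField f u d r (X (Set.projIic 0 (-r))) := by
  rw [hX.integral_eq, setIntegral_eq_neg_reversedField, coe_projIic_of_nonpos (by linarith),
    neg_neg]

theorem IsBackwardTrajectory.intervalIntegrable {x : State n} {X : BackwardTime → State n}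
    (hX : IsBackwardTrajectory f u d x X) {s : ℝ} (hs : 0 ≤ s) :
    IntervalIntegrable (fun r => reversedField f u d r (X (Set.projIic 0 (-r)))) volume 0 s := by
  have h := ((integrableOn_Ici_timeMeasure_iff _ _).1 (hX.integrableOn (Set.projIic 0 (-s)))).neg
  rwa [coe_projIic_of_nonpos (by linarith), neg_neg] at h

theorem IsBackwardTrajectory.continuous_comp {x : State n} {X : BackwardTime → State n}
    (hX : IsBackwardTrajectory f u d x X) {M : ℝ} (hM : ∀ y a b, ‖f y a b‖ ≤ M) :
    Continuous fun s : ℝ => X (Set.projIic 0 (-s)) := by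
  have hM0 : 0 ≤ M := (norm_nonneg _).trans
    (hM 0 (u.1 (Set.projIic 0 0)) (d.1 (Set.projIic 0 0)))
  have hmax : ∀ s : ℝ, X (Set.projIic 0 (-s)) = X (Set.projIic 0 (-max s 0)) := fun s => by
    congr 1
    rcases le_total s 0 with h | h
    · rw [max_eq_right h, Set.projIic_of_le (by linarith), Set.projIic_of_le (by simp)]
    · rw [max_eq_left h]
  refine (LipschitzWith.of_dist_le_mul (K := ⟨M, hM0⟩) fun s s' => ?_).continuous
  rw [hmax s, hmax s', hX.eq_add_integral (le_max_right _ _),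
    hX.eq_add_integral (le_max_right _ _), dist_add_left, dist_eq_norm,
    intervalIntegral.integral_interval_sub_left (hX.intervalIntegrable (le_max_right _ _))
      (hX.intervalIntegrable (le_max_right _ _))]
  refine (intervalIntegral.norm_integral_le_of_norm_le_const (C := M) fun r _ => ?_).trans ?_
  · rw [reversedField, norm_neg]
    exact hM _ _ _
  · exact mul_le_mul_of_nonneg_left (abs_max_sub_max_le_abs _ _ _) hM0

theorem IsBackwardTrajectory.shift {x : State n} {X : BackwardTime → State n}
    (hX : IsBackwardTrajectory f u d x X) (T : ℝ≥0) :
    IsBackwardTrajectory f (shiftSignal T u) (shiftSignal T d) (X (negTime T))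
      (fun τ => X (shiftTime T τ)) := by
  have hshift : ∀ r : ℝ, 0 ≤ r →
      reversedField f (shiftSignal T u) (shiftSignal T d) r (X (shiftTime T (Set.projIic 0 (-r))))
        = reversedField f u d (r + T) (X (Set.projIic 0 (-(r + T)))) := fun r hr => by
    simp only [reversedField, shiftSignal]
    rw [shiftTime_projIic T (by linarith), neg_add, sub_eq_add_neg]
  have hT : negTime T = Set.projIic 0 (-(T : ℝ)) :=
    Subtype.ext (coe_projIic_of_nonpos (neg_nonpos.2 T.2)).symm
  have hint : ∀ s : ℝ, 0 ≤ s → IntervalIntegrable (fun r => reversedField f u d (r + T)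
      (X (Set.projIic 0 (-(r + T))))) volume 0 s := fun s hs => by
    have h := ((hX.intervalIntegrable T.coe_nonneg).symm.trans
      (hX.intervalIntegrable (add_nonneg hs T.2))).comp_add_right T
    simpa using h
  refine ⟨fun t => ?_, fun t => ?_⟩
  · rw [integrableOn_Ici_timeMeasure_iff]
    have h := (hint (-t) (neg_nonneg.2 t.2)).neg
    refine h.congr fun r hr => ?_
    have hr0 : 0 ≤ r := by
      rw [Set.uIoc_of_le (neg_nonneg.2 t.2)] at hr
      exact hr.1.le
    have := congrArg Neg.neg (hshift r hr0)
    simp only [reversedField, neg_neg] at this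
    simp only [Pi.neg_apply, this, reversedField, neg_neg]
  · rw [setIntegral_eq_neg_reversedField, intervalIntegral.integral_congr (g := fun r =>
      reversedField f u d (r + T) (X (Set.projIic 0 (-(r + T))))), hT, hX.eq_add_integral T.coe_nonneg,
      intervalIntegral.integral_comp_add_right (fun r =>
        reversedField f u d r (X (Set.projIic 0 (-r)))), zero_add, add_assoc,
      intervalIntegral.integral_add_adjacent_intervals (hX.intervalIntegrable T.coe_nonneg)]
    · have hs : 0 ≤ -(t : ℝ) + T := add_nonneg (neg_nonneg.2 t.2) T.2
      rw [← hX.eq_add_integral hs, neg_add, neg_neg, ← sub_eq_add_neg, ← shiftTime_projIic T t.2,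
        projIic_coe]
    · have h1 := hX.intervalIntegrable T.coe_nonneg
      exact h1.symm.trans (hX.intervalIntegrable (add_nonneg (neg_nonneg.2 t.2) T.2))
    · intro r hr
      rw [Set.uIcc_of_le (neg_nonneg.2 t.2)] at hr
      exact hshift r hr.1

variable [UniformSpace A] [UniformSpace B] [BorelSpace A] [BorelSpace B]
  [SecondCountableTopology A] [SecondCountableTopology B]

theorem caratheodoryField_reversedField {L : ℝ≥0} {M : ℝ}
    (hc : Continuous fun p : State n × A × B => f p.1 p.2.1 p.2.2)
    (hL : ∀ a b, LipschitzWith L fun x => f x a b) (hM : ∀ y a b, ‖f y a b‖ ≤ M)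
    (u : BackwardSignal A) (d : BackwardSignal B) :
    CaratheodoryField (reversedField f u d) L M where
  bound r y := by rw [reversedField, norm_neg]; exact hM _ _ _
  lipschitz r := (hL _ _).neg
  measurable Y hY := by
    have hneg : Measure.QuasiMeasurePreserving (fun r : ℝ => -r) volume volume :=
      (Measure.measurePreserving_neg volume).quasiMeasurePreserving
    have hu := ((nullMeasurable_comp_projIic u.2).comp_quasiMeasurePreserving hneg).aemeasurable
    have hd := ((nullMeasurable_comp_projIic d.2).comp_quasiMeasurePreserving hneg).aemeasurable
    exact ((hc.measurable.comp_aemeasurable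
      (hY.measurable.aemeasurable.prodMk (hu.prodMk hd))).neg).aestronglyMeasurable

theorem isBackwardTrajectory_backwardTrajectory (hf : VectorFieldConditions f)
    (u : BackwardSignal A) (d : BackwardSignal B) (x : State n) :
    IsBackwardTrajectory f u d x (backwardTrajectory f u d x) := by
  obtain ⟨L, hL⟩ := hf.lipschitz
  obtain ⟨M, -, hM⟩ := hf.bounded
  have hG := caratheodoryField_reversedField hf.uniformContinuous.continuous hL hM u d
  obtain ⟨Y, hYc, hY⟩ := hG.exists_solution x
  refine Classical.epsilon_spec (p := IsBackwardTrajectory f u d x) ⟨fun t => Y (-t), ?_, ?_⟩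
  · intro t
    rw [integrableOn_Ici_timeMeasure_iff]
    refine (hG.intervalIntegrable hYc 0 (-t)).neg.congr fun r hr => ?_
    rw [Set.uIoc_of_le (neg_nonneg.2 t.2)] at hr
    simp only [Pi.neg_apply, reversedField, neg_neg,
      coe_projIic_of_nonpos (neg_nonpos.2 hr.1.le)]
  · intro t
    rw [setIntegral_eq_neg_reversedField (X := fun t => Y (-t)), hY _ (neg_nonneg.2 t.2)]
    congr 1
    refine intervalIntegral.integral_congr fun r hr => ?_
    rw [Set.uIcc_of_le (neg_nonneg.2 t.2)] at hr
    simp only [coe_projIic_of_nonpos (neg_nonpos.2 hr.1), neg_neg]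

theorem IsBackwardTrajectory.norm_sub_le (hf : VectorFieldConditions f) {L : ℝ≥0}
    (hL : ∀ a b, LipschitzWith L fun x => f x a b) {x x' : State n}
    {X X' : BackwardTime → State n} (hX : IsBackwardTrajectory f u d x X)
    (hX' : IsBackwardTrajectory f u' d' x' X') {s : ℝ} (hu : AgreeFrom s u u')
    (hd : AgreeFrom s d d') {t : BackwardTime} (ht : s ≤ t) :
    ‖X t - X' t‖ ≤ ‖x - x'‖ * Real.exp (L * -t) := by
  obtain ⟨M, -, hM⟩ := hf.bounded
  have hG := fun u d => caratheodoryField_reversedField hf.uniformContinuous.continuous hL hM u d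
  have h := (hG u d).norm_sub_le (hG u' d') (hX.continuous_comp hM) (hX'.continuous_comp hM)
    (x := x) (x' := x') (S := -t) ?_
    (fun s hs => hX.eq_add_integral hs.1) (fun s hs => hX'.eq_add_integral hs.1)
    (-t) ⟨neg_nonneg.2 t.2, le_rfl⟩
  · simpa [projIic_coe] using h
  · have hneg : Measure.QuasiMeasurePreserving (fun r : ℝ => -r) volume volume :=
      (Measure.measurePreserving_neg volume).quasiMeasurePreserving
    filter_upwards [hneg.ae (agreeFrom_iff.1 hu), hneg.ae (agreeFrom_iff.1 hd)] with r h1 h2 hr hrt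
    funext y
    rw [reversedField, reversedField, h1 (by linarith) (by linarith), h2 (by linarith) (by linarith)]

theorem backwardTrajectory_eq_of_agreeFrom (hf : VectorFieldConditions f) (x : State n) {s : ℝ}
    (hu : AgreeFrom s u u') (hd : AgreeFrom s d d') {t : BackwardTime} (ht : s ≤ t) :
    backwardTrajectory f u d x t = backwardTrajectory f u' d' x t := by
  obtain ⟨L, hL⟩ := hf.lipschitz
  have h := (isBackwardTrajectory_backwardTrajectory hf u d x).norm_sub_le hf hL
    (isBackwardTrajectory_backwardTrajectory hf u' d' x) hu hd ht
  rw [sub_self, norm_zero, zero_mul] at h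
  exact sub_eq_zero.1 (norm_le_zero_iff.1 h)

theorem backwardTrajectory_shiftTime (hf : VectorFieldConditions f) (x : State n)
    (u : BackwardSignal A) (d : BackwardSignal B) (T : ℝ≥0) (t : BackwardTime) :
    backwardTrajectory f u d x (shiftTime T t)
      = backwardTrajectory f (shiftSignal T u) (shiftSignal T d)
          (backwardTrajectory f u d x (negTime T)) t := by
  obtain ⟨L, hL⟩ := hf.lipschitz
  have h := ((isBackwardTrajectory_backwardTrajectory hf u d x).shift T).norm_sub_le hf hL
    (isBackwardTrajectory_backwardTrajectory hf (shiftSignal T u) (shiftSignal T d)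
      (backwardTrajectory f u d x (negTime T))) (AgreeFrom.refl t _) (AgreeFrom.refl t _)
    (le_refl (t : ℝ))
  rw [sub_self, norm_zero, zero_mul] at h
  exact sub_eq_zero.1 (norm_le_zero_iff.1 h)

end Trajectory

section SupInf

theorem abs_ciSup_le {ι : Type*} [Nonempty ι] {φ : ι → ℝ} {C : ℝ} (h : ∀ i, |φ i| ≤ C) :
    |⨆ i, φ i| ≤ C := by
  have hb : BddAbove (Set.range φ) := ⟨C, by rintro _ ⟨i, rfl⟩; exact (abs_le.1 (h i)).2⟩
  refine abs_le.2 ⟨?_, ciSup_le fun i => (abs_le.1 (h i)).2⟩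
  obtain ⟨i⟩ := ‹Nonempty ι›
  exact (abs_le.1 (h i)).1.trans (le_ciSup hb i)

theorem abs_ciInf_le {ι : Type*} [Nonempty ι] {φ : ι → ℝ} {C : ℝ} (h : ∀ i, |φ i| ≤ C) :
    |⨅ i, φ i| ≤ C := by
  have hb : BddBelow (Set.range φ) := ⟨-C, by rintro _ ⟨i, rfl⟩; exact (abs_le.1 (h i)).1⟩
  refine abs_le.2 ⟨le_ciInf fun i => (abs_le.1 (h i)).1, ?_⟩
  obtain ⟨i⟩ := ‹Nonempty ι›
  exact (ciInf_le hb i).trans (abs_le.1 (h i)).2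

theorem ciSup_le_ciSup_add {ι : Type*} [Nonempty ι] {φ ψ : ι → ℝ} {C ε : ℝ}
    (hψ : ∀ i, |ψ i| ≤ C) (h : ∀ i, φ i ≤ ψ i + ε) : ⨆ i, φ i ≤ (⨆ i, ψ i) + ε :=
  ciSup_le fun i => (h i).trans (add_le_add_left
    (le_ciSup ⟨C, by rintro _ ⟨i, rfl⟩; exact (abs_le.1 (hψ i)).2⟩ i) ε)

/-- Comparison of two sup-inf values: for every outer choice `i` in the first game there is an
answer `i'` in the second, such that every inner choice `j'` there is matched by some `j`. -/
theorem iSup_iInf_le_iSup_iInf_add {I J I' J' : Type*} [Nonempty I] [Nonempty J']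
    {F : I → J → ℝ} {G : I' → J' → ℝ} {C δ : ℝ} (hF : ∀ i j, |F i j| ≤ C)
    (hG : ∀ i j, |G i j| ≤ C) (h : ∀ i, ∃ i', ∀ j', ∃ j, F i j ≤ G i' j' + δ) :
    ⨆ i, ⨅ j, F i j ≤ (⨆ i, ⨅ j, G i j) + δ := by
  refine ciSup_le fun i => ?_
  obtain ⟨i', hi'⟩ := h i
  have hG' : BddAbove (Set.range fun i => ⨅ j, G i j) :=
    ⟨C, by rintro _ ⟨i, rfl⟩; exact (abs_le.1 (abs_ciInf_le (hG i))).2⟩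
  refine le_trans ?_ (add_le_add_left (le_ciSup hG' i') δ)
  rw [← sub_le_iff_le_add]
  refine le_ciInf fun j' => ?_
  obtain ⟨j, hj⟩ := hi' j'
  exact sub_le_iff_le_add.2
    ((ciInf_le ⟨-C, by rintro _ ⟨j, rfl⟩; exact (abs_le.1 (hF i j)).1⟩ j).trans hj)

theorem abs_iSup_iInf_sub_le {I J : Type*} [Nonempty I] [Nonempty J]
    {F G : I → J → ℝ} {C δ : ℝ} (hF : ∀ i j, |F i j| ≤ C)
    (hG : ∀ i j, |G i j| ≤ C) (h : ∀ i j, |F i j - G i j| ≤ δ) :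
    |(⨆ i, ⨅ j, F i j) - ⨆ i, ⨅ j, G i j| ≤ δ := by
  have h1 := iSup_iInf_le_iSup_iInf_add (δ := δ) hF hG fun i => ⟨i, fun j => ⟨j, by
    linarith [(abs_le.1 (h i j)).2]⟩⟩
  have h2 := iSup_iInf_le_iSup_iInf_add (δ := δ) hG hF fun i => ⟨i, fun j => ⟨j, by
    linarith [(abs_le.1 (h i j)).1]⟩⟩
  exact abs_le.2 ⟨by linarith, by linarith⟩

end SupInf

section SupNorm

variable {n : ℕ}

theorem supNorm_le {V : State n → ℝ} {c : ℝ} (h : ∀ x, |V x| ≤ c) : supNorm V ≤ c :=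
  ciSup_le h

theorem abs_le_supNorm {V : State n → ℝ} {C : ℝ} (h : ∀ x, |V x| ≤ C) (x : State n) :
    |V x| ≤ supNorm V :=
  le_ciSup (f := fun x => |V x|) ⟨C, by rintro _ ⟨i, rfl⟩; exact h i⟩ x

theorem supNorm_nonneg (V : State n → ℝ) : 0 ≤ supNorm V :=
  Real.iSup_nonneg fun _ => abs_nonneg _

end SupNorm

section Game

variable {n : ℕ} {A B : Type*} [MeasurableSpace A] [MeasurableSpace B]
  {f : State n → A → B → State n} {h : State n → ℝ} {γ : ℝ} {T : ℝ≥0}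
  {u u' : BackwardSignal A} {d d' : BackwardSignal B}

/-- The discounted running reward at time `t`. -/
noncomputable def runningReward (f : State n → A → B → State n) (h : State n → ℝ) (γ : ℝ)
    (x : State n) (u : BackwardSignal A) (d : BackwardSignal B) (t : BackwardTime) : ℝ :=
  Real.exp (γ * (t : ℝ)) * h (backwardTrajectory f u d x t)

/-- The Bellman payoff over `[-T, 0]` with terminal reward `V`, along fixed signals. -/
noncomputable def stagePayoff (f : State n → A → B → State n) (h : State n → ℝ) (γ : ℝ)
    (T : ℝ≥0) (V : State n → ℝ) (x : State n) (u : BackwardSignal A) (d : BackwardSignal B) : ℝ :=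
  max (⨆ t : Set.Ici (negTime T), runningReward f h γ x u d t)
    (Real.exp (-(γ * T)) * V (backwardTrajectory f u d x (negTime T)))

instance : Nonempty (Set.Ici (negTime T)) := ⟨⟨negTime T, Set.self_mem_Ici⟩⟩

theorem abs_runningReward_le (hγ : 0 < γ) {C : ℝ} (hC : ∀ x, |h x| ≤ C) (x : State n)
    (u : BackwardSignal A) (d : BackwardSignal B) (t : BackwardTime) :
    |runningReward f h γ x u d t| ≤ C := by
  rw [runningReward, abs_mul, abs_of_pos (Real.exp_pos _)]
  have h1 : Real.exp (γ * (t : ℝ)) ≤ 1 :=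
    Real.exp_le_one_iff.2 (mul_nonpos_of_nonneg_of_nonpos hγ.le t.2)
  exact (mul_le_of_le_one_left (abs_nonneg _) h1).trans (hC _)

theorem exp_neg_mul_le_one (hγ : 0 < γ) (T : ℝ≥0) : Real.exp (-(γ * T)) ≤ 1 :=
  Real.exp_le_one_iff.2 (neg_nonpos.2 (mul_nonneg hγ.le T.coe_nonneg))

theorem abs_stagePayoff_le (hγ : 0 < γ) {C : ℝ} (hC : ∀ x, |h x| ≤ C) {V : State n → ℝ}
    (hV : ∀ x, |V x| ≤ C) (x : State n) (u : BackwardSignal A) (d : BackwardSignal B) :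
    |stagePayoff f h γ T V x u d| ≤ C := by
  refine abs_max_le_max_abs_abs.trans (max_le (abs_ciSup_le fun t =>
    abs_runningReward_le hγ hC _ _ _ _) ?_)
  rw [abs_mul, abs_of_pos (Real.exp_pos _)]
  exact (mul_le_of_le_one_left (abs_nonneg _) (exp_neg_mul_le_one hγ T)).trans (hV _)

theorem abs_stagePayoff_sub_le {V W : State n → ℝ} {δ : ℝ} (hδ : ∀ x, |V x - W x| ≤ δ)
    (x : State n) (u : BackwardSignal A) (d : BackwardSignal B) :
    |stagePayoff f h γ T V x u d - stagePayoff f h γ T W x u d| ≤ Real.exp (-(γ * T)) * δ := by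
  refine (abs_max_sub_max_le_max _ _ _ _).trans (max_le ?_ ?_)
  · rw [sub_self, abs_zero]
    exact mul_nonneg (Real.exp_pos _).le ((abs_nonneg _).trans (hδ 0))
  · rw [← mul_sub, abs_mul, abs_of_pos (Real.exp_pos _)]
    exact mul_le_mul_of_nonneg_left (hδ _) (Real.exp_pos _).le

variable [Nonempty A] [Nonempty B]

theorem abs_bellmanBackup_le (hγ : 0 < γ) {C : ℝ} (hC : ∀ x, |h x| ≤ C) {V : State n → ℝ}
    (hV : ∀ x, |V x| ≤ C) (x : State n) : |bellmanBackup f h γ T V x| ≤ C :=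
  abs_ciSup_le fun ξ => abs_ciInf_le fun u => abs_stagePayoff_le hγ hC hV x u (ξ.1 u)

theorem abs_frtValue_le (hγ : 0 < γ) {C : ℝ} (hC : ∀ x, |h x| ≤ C) (x : State n) :
    |frtValue f h γ x| ≤ C :=
  abs_ciSup_le fun ξ => abs_ciInf_le fun u => abs_ciSup_le fun t =>
    abs_runningReward_le hγ hC x u (ξ.1 u) t

theorem abs_bellmanBackup_sub_le (hγ : 0 < γ) {C : ℝ} (hC : ∀ x, |h x| ≤ C)
    {V W : State n → ℝ} (hV : ∀ x, |V x| ≤ C) (hW : ∀ x, |W x| ≤ C) {δ : ℝ}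
    (hδ : ∀ x, |V x - W x| ≤ δ) (x : State n) :
    |bellmanBackup f h γ T V x - bellmanBackup f h γ T W x| ≤ Real.exp (-(γ * T)) * δ :=
  abs_iSup_iInf_sub_le (fun ξ u => abs_stagePayoff_le hγ hC hV x u (ξ.1 u))
    (fun ξ u => abs_stagePayoff_le hγ hC hW x u (ξ.1 u))
    (fun ξ u => abs_stagePayoff_sub_le hδ x u (ξ.1 u))

theorem supNorm_bellmanBackup_sub_le (hγ : 0 < γ) (hh : IsBUC h) {V W : State n → ℝ}
    (hV : IsBUC V) (hW : IsBUC W) (T : ℝ≥0) :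
    supNorm (bellmanBackup f h γ T V - bellmanBackup f h γ T W)
      ≤ Real.exp (-(γ * T)) * supNorm (V - W) := by
  obtain ⟨C₀, hC₀⟩ := hh.bounded
  obtain ⟨C₁, hC₁⟩ := hV.bounded
  obtain ⟨C₂, hC₂⟩ := hW.bounded
  have hb : ∀ x, |(V - W) x| ≤ C₁ + C₂ := fun x =>
    (abs_sub _ _).trans (add_le_add (hC₁ x) (hC₂ x))
  exact supNorm_le fun x => abs_bellmanBackup_sub_le (C := max C₀ (max C₁ C₂)) hγ
    (fun x => (hC₀ x).trans (le_max_left _ _))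
    (fun x => (hC₁ x).trans (le_max_of_le_right (le_max_left _ _)))
    (fun x => (hC₂ x).trans (le_max_of_le_right (le_max_right _ _)))
    (abs_le_supNorm hb) x

variable [UniformSpace A] [UniformSpace B] [BorelSpace A] [BorelSpace B]
  [SecondCountableTopology A] [SecondCountableTopology B]

theorem uniformContinuous_bellmanBackup (hf : VectorFieldConditions f) (hγ : 0 < γ)
    (hh : IsBUC h) {V : State n → ℝ} (hV : IsBUC V) (T : ℝ≥0) :
    UniformContinuous (bellmanBackup f h γ T V) := by
  obtain ⟨L, hL⟩ := hf.lipschitz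
  obtain ⟨C₁, hC₁⟩ := hh.bounded
  obtain ⟨C₂, hC₂⟩ := hV.bounded
  have hC₁' : ∀ x, |h x| ≤ max C₁ C₂ := fun x => (hC₁ x).trans (le_max_left _ _)
  have hC₂' : ∀ x, |V x| ≤ max C₁ C₂ := fun x => (hC₂ x).trans (le_max_right _ _)
  rw [Metric.uniformContinuous_iff]
  intro ε hε
  obtain ⟨δ₁, hδ₁, H₁⟩ := Metric.uniformContinuous_iff.1 hh.uniformContinuous (ε / 2) (half_pos hε)
  obtain ⟨δ₂, hδ₂, H₂⟩ := Metric.uniformContinuous_iff.1 hV.uniformContinuous (ε / 2) (half_pos hε)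
  refine ⟨min δ₁ δ₂ / Real.exp (L * T), by positivity, fun {x y} hxy => ?_⟩
  refine lt_of_le_of_lt ?_ (half_lt_self hε)
  rw [Real.dist_eq]
  have hdist : ∀ (u : BackwardSignal A) (d : BackwardSignal B) (t : BackwardTime),
      negTime T ≤ t → dist (backwardTrajectory f u d x t) (backwardTrajectory f u d y t)
        < min δ₁ δ₂ := fun u d t ht => by
    rw [lt_div_iff₀ (Real.exp_pos _), dist_eq_norm] at hxy
    refine lt_of_le_of_lt ?_ hxy
    have h1 := (isBackwardTrajectory_backwardTrajectory hf u d x).norm_sub_le hf hL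
      (isBackwardTrajectory_backwardTrajectory hf u d y) (AgreeFrom.refl t u) (AgreeFrom.refl t d)
      (le_refl (t : ℝ))
    rw [dist_eq_norm]
    refine h1.trans ?_
    have h2 : -(T : ℝ) ≤ t := ht
    gcongr
    linarith
  have hexp : ∀ {a b c : ℝ}, 0 < a → a ≤ 1 → dist b c < ε / 2 → |a * b - a * c| ≤ ε / 2 :=
    fun {a b c} ha ha1 hbc => by
      rw [← mul_sub, abs_mul, abs_of_pos ha]
      exact (mul_le_of_le_one_left (abs_nonneg _) ha1).trans (le_of_lt hbc)
  have hrun : ∀ (u : BackwardSignal A) (d : BackwardSignal B) (t : Set.Ici (negTime T)),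
      |runningReward f h γ x u d t - runningReward f h γ y u d t| ≤ ε / 2 := fun u d t =>
    hexp (Real.exp_pos _)
      (Real.exp_le_one_iff.2 (mul_nonpos_of_nonneg_of_nonpos hγ.le t.1.2))
      (H₁ ((hdist u d t t.2).trans_le (min_le_left _ _)))
  refine abs_iSup_iInf_sub_le (fun ξ u => abs_stagePayoff_le hγ hC₁' hC₂' x u (ξ.1 u))
    (fun ξ u => abs_stagePayoff_le hγ hC₁' hC₂' y u (ξ.1 u)) (fun ξ u => ?_)
  refine (abs_max_sub_max_le_max _ _ _ _).trans (max_le ?_ ?_)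
  · have h1 := ciSup_le_ciSup_add (ι := Set.Ici (negTime T)) (ε := ε / 2)
      (fun t => abs_runningReward_le (f := f) hγ hC₁ y u (ξ.1 u) t)
      (fun t => by linarith [(abs_le.1 (hrun u (ξ.1 u) t)).2] :
        ∀ t : Set.Ici (negTime T), runningReward f h γ x u (ξ.1 u) t ≤ _)
    have h2 := ciSup_le_ciSup_add (ι := Set.Ici (negTime T)) (ε := ε / 2)
      (fun t => abs_runningReward_le (f := f) hγ hC₁ x u (ξ.1 u) t)
      (fun t => by linarith [(abs_le.1 (hrun u (ξ.1 u) t)).1] :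
        ∀ t : Set.Ici (negTime T), runningReward f h γ y u (ξ.1 u) t ≤ _)
    exact abs_le.2 ⟨neg_le_sub_iff_le_add.2 h2, sub_le_iff_le_add'.2 h1⟩
  · exact hexp (Real.exp_pos _) (exp_neg_mul_le_one hγ T)
      (H₂ ((hdist u (ξ.1 u) _ le_rfl).trans_le (min_le_right _ _)))

theorem isBUC_bellmanBackup (hf : VectorFieldConditions f) (hγ : 0 < γ)
    (hh : IsBUC h) {V : State n → ℝ} (hV : IsBUC V) (T : ℝ≥0) :
    IsBUC (bellmanBackup f h γ T V) := by
  obtain ⟨C₁, hC₁⟩ := hh.bounded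
  obtain ⟨C₂, hC₂⟩ := hV.bounded
  exact ⟨⟨max C₁ C₂, abs_bellmanBackup_le hγ (fun x => (hC₁ x).trans (le_max_left _ _))
    fun x => (hC₂ x).trans (le_max_right _ _)⟩, uniformContinuous_bellmanBackup hf hγ hh hV T⟩

omit [Nonempty A] [Nonempty B] in
/-- The reward over `(-∞, 0]` splits at time `-T`. -/
theorem iSup_runningReward_eq_max (hf : VectorFieldConditions f) (hγ : 0 < γ) {C : ℝ}
    (hC : ∀ x, |h x| ≤ C) (x : State n) (u : BackwardSignal A) (d : BackwardSignal B) (T : ℝ≥0) :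
    ⨆ t, runningReward f h γ x u d t =
      max (⨆ t : Set.Ici (negTime T), runningReward f h γ x u d t)
        (Real.exp (-(γ * T)) * ⨆ t, runningReward f h γ
          (backwardTrajectory f u d x (negTime T)) (shiftSignal T u) (shiftSignal T d) t) := by
  have hshift : ∀ t, runningReward f h γ x u d (shiftTime T t)
      = Real.exp (-(γ * T)) * runningReward f h γ
          (backwardTrajectory f u d x (negTime T)) (shiftSignal T u) (shiftSignal T d) t := by
    intro t
    rw [runningReward, runningReward, backwardTrajectory_shiftTime hf, ← mul_assoc, ← Real.exp_add]
    congr 2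
    simp only [shiftTime]
    ring
  have hbdd : BddAbove (Set.range (runningReward f h γ x u d)) :=
    ⟨C, by rintro _ ⟨t, rfl⟩; exact (abs_le.1 (abs_runningReward_le hγ hC x u d t)).2⟩
  rw [Real.mul_iSup_of_nonneg (Real.exp_pos _).le]
  simp only [← hshift]
  have : Nonempty BackwardTime := ⟨negTime 0⟩
  refine le_antisymm (ciSup_le fun t => ?_) (max_le (ciSup_le fun t => le_ciSup hbdd _)
    (ciSup_le fun t => le_ciSup hbdd _))
  rcases le_total (negTime T) t with ht | ht
  · exact le_max_of_le_left (le_ciSup (f := fun t : Set.Ici (negTime T) =>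
      runningReward f h γ x u d t) (hbdd.mono (by rintro _ ⟨t, rfl⟩; exact ⟨_, rfl⟩)) ⟨t, ht⟩)
  · have ht' : (t : ℝ) ≤ -T := ht
    have e : t = shiftTime T ⟨t + T, by simp only [Set.mem_Iic]; linarith⟩ :=
      Subtype.ext (by simp [shiftTime])
    refine le_max_of_le_right ?_
    rw [e]
    exact le_ciSup (f := fun t => runningReward f h γ x u d (shiftTime T t))
      (hbdd.mono (by rintro _ ⟨t, rfl⟩; exact ⟨_, rfl⟩)) _

omit [Nonempty A] [Nonempty B] in
theorem stagePayoff_congr (hf : VectorFieldConditions f) (V : State n → ℝ) (x : State n)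
    (hu : AgreeFrom (-T) u u') (hd : AgreeFrom (-T) d d') :
    stagePayoff f h γ T V x u d = stagePayoff f h γ T V x u' d' := by
  have key : ∀ t : BackwardTime, negTime T ≤ t →
      backwardTrajectory f u d x t = backwardTrajectory f u' d' x t := fun t ht =>
    backwardTrajectory_eq_of_agreeFrom hf x hu hd ht
  rw [stagePayoff, stagePayoff, key _ le_rfl]
  congr 1
  refine iSup_congr fun t => ?_
  rw [runningReward, runningReward, key t t.2]

/-- Follow `ξ` on `[-T, 0]`, then the strategy assigned to the state reached at `-T`. -/
noncomputable def concatStrategy (hf : VectorFieldConditions f) (x : State n) (T : ℝ≥0)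
    (ξ : BackwardStrategy A B) (Ξ : State n → BackwardStrategy A B) : BackwardStrategy A B :=
  ⟨fun u => concatSignal T (ξ.1 u)
      ((Ξ (backwardTrajectory f u (ξ.1 u) x (negTime T))).1 (shiftSignal T u)),
    fun s hs u v huv => by
      refine AgreeFrom.concatSignal T ((ξ.2 s hs u v huv).mono (le_max_left _ _)) fun hsT => ?_
      have hT : AgreeFrom (-T : ℝ) u v := huv.mono hsT.le
      rw [backwardTrajectory_eq_of_agreeFrom hf x hT
        (ξ.2 _ (neg_nonpos.2 T.coe_nonneg) u v hT) (t := negTime T) le_rfl]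
      exact (Ξ _).2 _ (by linarith) _ _ (AgreeFrom.shiftSignal T (by simpa using huv))⟩

/-- The response of `ξ` before time `-T`, once the control `u` was played on `(-T, 0]`. -/
noncomputable def tailStrategy (T : ℝ≥0) (u : BackwardSignal A) (ξ : BackwardStrategy A B) :
    BackwardStrategy A B :=
  ⟨fun v => shiftSignal T (ξ.1 (concatSignal T u v)), fun s hs v w hvw =>
    AgreeFrom.shiftSignal T (ξ.2 _ (sub_nonpos.2 (hs.trans T.coe_nonneg)) _ _
      (AgreeFrom.concatSignal T (AgreeFrom.refl _ _) fun _ => by simpa using hvw))⟩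

/-- The dynamic programming principle. -/
theorem bellmanBackup_frtValue (hf : VectorFieldConditions f) (hγ : 0 < γ) (hh : IsBUC h)
    (T : ℝ≥0) : bellmanBackup f h γ T (frtValue f h γ) = frtValue f h γ := by
  obtain ⟨C, hC⟩ := hh.bounded
  have : Nonempty BackwardTime := ⟨negTime 0⟩
  have hS := fun x (ξ : BackwardStrategy A B) u =>
    abs_stagePayoff_le (f := f) (T := T) hγ hC (abs_frtValue_le (f := f) hγ hC) x u (ξ.1 u)
  have hR : ∀ x (ξ : BackwardStrategy A B) u, |discountedCost f h γ x u ξ| ≤ C := fun x ξ u =>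
    abs_ciSup_le fun t => abs_runningReward_le hγ hC x u (ξ.1 u) t
  have hsplit : ∀ x u (ξ : BackwardStrategy A B), discountedCost f h γ x u ξ = _ := fun x u ξ =>
    iSup_runningReward_eq_max hf hγ hC x u (ξ.1 u) T
  have hinf : ∀ x (ξ : BackwardStrategy A B), BddBelow (Set.range fun u =>
      discountedCost f h γ x u ξ) := fun x ξ =>
    ⟨-C, by rintro _ ⟨u, rfl⟩; exact (abs_le.1 (hR x ξ u)).1⟩
  have hsup : ∀ x, BddAbove (Set.range fun ξ : BackwardStrategy A B =>
      ⨅ u, discountedCost f h γ x u ξ) := fun x =>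
    ⟨C, by rintro _ ⟨ξ, rfl⟩; exact (abs_le.1 (abs_ciInf_le (hR x ξ))).2⟩
  have hmax : ∀ {a b c δ : ℝ}, 0 < δ → b ≤ c + δ →
      max a (Real.exp (-(γ * T)) * b) ≤ max a (Real.exp (-(γ * T)) * c) + δ :=
    fun {a b c δ} hδ hbc => by
      refine max_le (by linarith [le_max_left a (Real.exp (-(γ * T)) * c)]) ?_
      have h1 := le_max_right a (Real.exp (-(γ * T)) * c)
      have h2 := Real.exp_pos (-(γ * T))
      have h3 := exp_neg_mul_le_one hγ T
      nlinarith
  funext x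
  refine le_antisymm (le_of_forall_pos_le_add fun δ hδ => ?_)
    (le_of_forall_pos_le_add fun δ hδ => ?_)
  · have hopt : ∀ y, ∃ ξ : BackwardStrategy A B,
        frtValue f h γ y - δ < ⨅ u, discountedCost f h γ y u ξ := fun y =>
      exists_lt_of_lt_ciSup (sub_lt_self _ hδ)
    choose Ξ hΞ using hopt
    refine iSup_iInf_le_iSup_iInf_add (hS x) (hR x) fun ξ =>
      ⟨concatStrategy hf x T ξ Ξ, fun u => ⟨u, ?_⟩⟩
    have hd : AgreeFrom (-T) (ξ.1 u) ((concatStrategy hf x T ξ Ξ).1 u) := by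
      have h1 := agreeFrom_concatSignal_left T (ξ.1 u)
        ((Ξ (backwardTrajectory f u (ξ.1 u) x (negTime T))).1 (shiftSignal T u))
      exact Eventually.mono h1 fun τ hτ hs => (hτ hs).symm
    have hy := backwardTrajectory_eq_of_agreeFrom hf x (AgreeFrom.refl (-T) u) hd
      (t := negTime T) le_rfl
    have hsh : shiftSignal T ((concatStrategy hf x T ξ Ξ).1 u)
        = (Ξ (backwardTrajectory f u (ξ.1 u) x (negTime T))).1 (shiftSignal T u) :=
      shiftSignal_concatSignal T _ _
    change stagePayoff f h γ T (frtValue f h γ) x u (ξ.1 u) ≤ _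
    rw [stagePayoff_congr hf _ x (AgreeFrom.refl _ u) hd, hsplit, hsh, ← hy]
    rw [stagePayoff, ← hy]
    refine hmax hδ ?_
    have h1 := ciInf_le (hinf (backwardTrajectory f u (ξ.1 u) x (negTime T))
      (Ξ (backwardTrajectory f u (ξ.1 u) x (negTime T)))) (shiftSignal T u)
    have h2 := hΞ (backwardTrajectory f u (ξ.1 u) x (negTime T))
    have h3 := (h2.trans_le h1).le
    rw [sub_le_iff_le_add] at h3
    exact h3
  · refine iSup_iInf_le_iSup_iInf_add (hR x) (hS x) fun ξ => ⟨ξ, fun u => ?_⟩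
    set y := backwardTrajectory f u (ξ.1 u) x (negTime T) with hy
    have hlt : (⨅ v, discountedCost f h γ y v (tailStrategy T u ξ)) < frtValue f h γ y + δ :=
      (le_ciSup (hsup y) _).trans_lt (lt_add_of_pos_right _ hδ)
    obtain ⟨v, hv⟩ := exists_lt_of_ciInf_lt hlt
    have hu := agreeFrom_concatSignal_left T u v
    have hd := ξ.2 _ (neg_nonpos.2 T.coe_nonneg) _ _ hu
    have hyc : backwardTrajectory f (concatSignal T u v) (ξ.1 (concatSignal T u v)) x (negTime T)
        = y := backwardTrajectory_eq_of_agreeFrom hf x hu hd (t := negTime T) le_rfl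
    refine ⟨concatSignal T u v, ?_⟩
    change _ ≤ stagePayoff f h γ T (frtValue f h γ) x u (ξ.1 u) + δ
    rw [← stagePayoff_congr hf _ x hu hd, hsplit, hyc, shiftSignal_concatSignal, stagePayoff, hyc]
    exact hmax hδ hv.le

theorem isBUC_frtValue (hf : VectorFieldConditions f) (hγ : 0 < γ) (hh : IsBUC h) :
    IsBUC (frtValue f h γ) := by
  obtain ⟨C, hC⟩ := hh.bounded
  have hC0 : 0 ≤ C := (abs_nonneg _).trans (hC 0)
  refine ⟨⟨C, abs_frtValue_le hγ hC⟩, ?_⟩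
  have hzero : IsBUC (fun _ : State n => (0 : ℝ)) := ⟨⟨0, by simp⟩, uniformContinuous_const⟩
  have hlim : Tendsto (fun k : ℕ => Real.exp (-(γ * (k : ℝ≥0))) * C) atTop (𝓝 0) := by
    have h1 : Tendsto (fun k : ℕ => γ * ((k : ℝ≥0) : ℝ)) atTop atTop := by
      simpa using tendsto_natCast_atTop_atTop.const_mul_atTop hγ
    simpa using (Real.tendsto_exp_neg_atTop_nhds_zero.comp h1).mul_const C
  have hunif : TendstoUniformly (fun (k : ℕ) x => bellmanBackup f h γ k (fun _ => 0) x)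
      (frtValue f h γ) atTop := by
    rw [Metric.tendstoUniformly_iff]
    intro ε hε
    filter_upwards [hlim.eventually (gt_mem_nhds hε)] with k hk x
    refine lt_of_le_of_lt ?_ hk
    rw [Real.dist_eq]
    nth_rewrite 1 [← bellmanBackup_frtValue hf hγ hh k]
    exact abs_bellmanBackup_sub_le hγ hC (abs_frtValue_le hγ hC) (by simpa using hC0)
      (by simpa using abs_frtValue_le hγ hC) x
  exact hunif.uniformContinuous
    (Frequently.of_forall fun k => uniformContinuous_bellmanBackup hf hγ hh hzero k)

theorem eq_frtValue_of_bellmanBackup_eq (hf : VectorFieldConditions f) (hγ : 0 < γ)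
    (hh : IsBUC h) (hT : 0 < T) {W : State n → ℝ} (hW : IsBUC W)
    (hfix : bellmanBackup f h γ T W = W) : W = frtValue f h γ := by
  have hV := isBUC_frtValue hf hγ hh
  obtain ⟨C₁, hC₁⟩ := hW.bounded
  obtain ⟨C₂, hC₂⟩ := hV.bounded
  have h1 := supNorm_bellmanBackup_sub_le (f := f) hγ hh hW hV T
  rw [hfix, bellmanBackup_frtValue hf hγ hh] at h1
  have h2 : Real.exp (-(γ * T)) < 1 :=
    Real.exp_lt_one_iff.2 (neg_neg_of_pos (mul_pos hγ (NNReal.coe_pos.2 hT)))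
  have h3 : supNorm (W - frtValue f h γ) ≤ 0 := by
    nlinarith [supNorm_nonneg (W - frtValue f h γ)]
  funext x
  have h4 := (abs_le_supNorm (V := W - frtValue f h γ) (C := C₁ + C₂)
    (fun x => (abs_sub _ _).trans (add_le_add (hC₁ x) (hC₂ x))) x).trans h3
  exact sub_eq_zero.1 (abs_nonpos_iff.1 h4)

theorem tendsto_supNorm_bellmanBackup_sub_frtValue (hf : VectorFieldConditions f) (hγ : 0 < γ)
    (hh : IsBUC h) {V : State n → ℝ} (hV : IsBUC V) :
    Tendsto (fun T : ℝ≥0 => supNorm (bellmanBackup f h γ T V - frtValue f h γ))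
      atTop (𝓝 0) := by
  have hlim : Tendsto (fun T : ℝ≥0 => Real.exp (-(γ * T)) * supNorm (V - frtValue f h γ))
      atTop (𝓝 0) := by
    have h1 : Tendsto (fun T : ℝ≥0 => γ * (T : ℝ)) atTop atTop :=
      (NNReal.tendsto_coe_atTop.2 tendsto_id).const_mul_atTop hγ
    simpa using (Real.tendsto_exp_neg_atTop_nhds_zero.comp h1).mul_const _
  refine squeeze_zero (fun _ => supNorm_nonneg _) (fun T => ?_) hlim
  nth_rewrite 1 [← bellmanBackup_frtValue hf hγ hh T]
  exact supNorm_bellmanBackup_sub_le hγ hh hV (isBUC_frtValue hf hγ hh) T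

end Game

theorem theorem3 {n mU mD : ℕ}
    (U : Set (EuclideanSpace ℝ (Fin mU))) (hU : IsCompact U) (hUne : U.Nonempty)
    (D : Set (EuclideanSpace ℝ (Fin mD))) (hD : IsCompact D) (hDne : D.Nonempty)
    (f : State n → U → D → State n) (hf : VectorFieldConditions f)
    (h : State n → ℝ) (hh : IsBUC h) (γ : ℝ) (hγ : 0 < γ) :
    (∀ T : ℝ≥0, 0 < T → ∀ V : State n → ℝ, IsBUC V → IsBUC (bellmanBackup f h γ T V)) ∧
    (∀ T : ℝ≥0, 0 < T → ∀ V₁ V₂ : State n → ℝ, IsBUC V₁ → IsBUC V₂ →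
      supNorm (bellmanBackup f h γ T V₁ - bellmanBackup f h γ T V₂)
        ≤ Real.exp (-(γ * T)) * supNorm (V₁ - V₂)) ∧
    IsBUC (frtValue f h γ) ∧
    (∀ T : ℝ≥0, 0 < T →
      bellmanBackup f h γ T (frtValue f h γ) = frtValue f h γ ∧
      ∀ W : State n → ℝ, IsBUC W → bellmanBackup f h γ T W = W → W = frtValue f h γ) ∧
    (∀ V : State n → ℝ, IsBUC V →
      Tendsto (fun T : ℝ≥0 => supNorm (bellmanBackup f h γ T V - frtValue f h γ))
        atTop (𝓝 0)) := by
  have : Nonempty U := hUne.to_subtype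
  have : Nonempty D := hDne.to_subtype
  exact ⟨fun T _ V hV => isBUC_bellmanBackup hf hγ hh hV T,
    fun T _ V₁ V₂ h₁ h₂ => supNorm_bellmanBackup_sub_le hγ hh h₁ h₂ T,
    isBUC_frtValue hf hγ hh,
    fun T hT => ⟨bellmanBackup_frtValue hf hγ hh T,
      fun W hW hfix => eq_frtValue_of_bellmanBackup_eq hf hγ hh hT hW hfix⟩,
    fun V hV => tendsto_supNorm_bellmanBackup_sub_frtValue hf hγ hh hV⟩
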